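/- Call $\eta\in\mathrm{GL}(n,\mathbb Z)$ semisimple if it is diagonalizable over $\mathbb C$ (equivalently, its unipotent Jordan factor is trivial). A subgroup of $\mathrm{GL}(n,\mathbb C)$ is unipotent if it is conjugate in $\mathrm{GL}(n,\mathbb C)$ into the group of upper triangular matrices with ones on the diagonal, and virtually unipotent if it has a unipotent subgroup of finite index. A congruence subgroup of $\mathrm{GL}(n,\mathbb Z)$ is a subgroup containing the kernel of the reduction $\mathrm{GL}(n,\mathbb Z)\to\mathrm{GL}(n,\mathbb Z/m\mathbb Z)$ for some integer $m\ge 1$. Let $\eta\in\mathrm{GL}(n,\mathbb Z)$ be semisimple with $\eta\neq 1$, and let $\Gamma<\mathrm{GL}(n,\mathbb Z)$ be a torsion free, virtually unipotent subgroup. Then there exists a congruence subgroup $\Lambda_0$ of $\mathrm{GL}(n,\mathbb Z)$ (in particular, a subgroup of finite index) such that $\Gamma\le\Lambda_0$ and $\Lambda_0$ contains no $\mathrm{GL}(n,\mathbb Z)$-conjugate of $\eta$, that is, $[\eta]\cap\Lambda_0=\emptyset$, where $[\eta]$ is the $\mathrm{GL}(n,\mathbb Z)$-conjugacy class of $\eta$.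 -/

import Mathlib

open scoped MatrixGroups

namespace UnipotentSelberg

/-- `γ = s * u` is the (multiplicative) Jordan decomposition of `γ ∈ GL(n, ℂ)`: the factor `s` is
diagonalizable, `u - 1` is nilpotent, and `s` and `u` commute. -/
def IsJordanDecomposition {n : ℕ} (γ s u : GL (Fin n) ℂ) : Prop :=
  γ = s * u ∧
  (∃ P : GL (Fin n) ℂ, (P⁻¹ * s * P : GL (Fin n) ℂ).val.IsDiag) ∧
  IsNilpotent (u.val - 1) ∧
  Commute s u

/-- The inclusion `GL(n, ℤ) → GL(n, ℂ)`. -/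
def toComplex (n : ℕ) : GL (Fin n) ℤ →* GL (Fin n) ℂ :=
  Matrix.GeneralLinearGroup.map (Int.castRingHom ℂ)

/-- The reduction homomorphism `GL(n, ℤ) → GL(n, ℤ/m)`. -/
def reduction (n m : ℕ) : GL (Fin n) ℤ →* GL (Fin n) (ZMod m) :=
  Matrix.GeneralLinearGroup.map (Int.castRingHom (ZMod m))

/-- An element of `GL(n, ℤ)` is semisimple if its unipotent Jordan factor over `ℂ` is trivial
(under this definition the identity is semisimple). -/
def IsSemisimpleElement {n : ℕ} (η : GL (Fin n) ℤ) : Prop :=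
  ∃ s : GL (Fin n) ℂ, IsJordanDecomposition (toComplex n η) s 1

/-- A subgroup of `GL(n, ℂ)` is unipotent if it is conjugate in `GL(n, ℂ)` into the group of upper
triangular matrices with ones along the diagonal. -/
def IsUnipotentSubgroup {n : ℕ} (U : Subgroup (GL (Fin n) ℂ)) : Prop :=
  ∃ P : GL (Fin n) ℂ, ∀ g ∈ U,
    (∀ i j : Fin n, j < i → (P⁻¹ * g * P : GL (Fin n) ℂ).val i j = 0) ∧
    (∀ i : Fin n, (P⁻¹ * g * P : GL (Fin n) ℂ).val i i = 1)

/-- A subgroup of `GL(n, ℂ)` is virtually unipotent if it has a unipotent subgroup of finite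
index. -/
def IsVirtuallyUnipotent {n : ℕ} (Γ : Subgroup (GL (Fin n) ℂ)) : Prop :=
  ∃ U : Subgroup (GL (Fin n) ℂ), U ≤ Γ ∧ (U.subgroupOf Γ).FiniteIndex ∧ IsUnipotentSubgroup U

/-- A subgroup is torsion free if its only element of finite order is the identity. (For
non-abelian groups this is weaker than Mathlib's `IsMulTorsionFree`, which asks for unique
roots.) -/
def IsTorsionFreeSubgroup {G : Type*} [Group G] (Γ : Subgroup G) : Prop :=
  ∀ g ∈ Γ, IsOfFinOrder g → g = 1

/-- A congruence subgroup of `GL(n, ℤ)` contains the kernel of reduction modulo some `m ≥ 1`. -/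
def IsCongruence {n : ℕ} (L : Subgroup (GL (Fin n) ℤ)) : Prop :=
  ∃ m : ℕ, 0 < m ∧ (reduction n m).ker ≤ L

end UnipotentSelberg

namespace UnipotentSelberg

/-- For a subgroup `H` of a finitely generated abelian group, elements of `H` that are sufficiently
divisible in the ambient group are divisible in `H`. -/
theorem exists_smul_mem_imp_eq_smul {M : Type*} [AddCommGroup M] [Module.Finite ℤ M]
    (H : AddSubgroup M) (K : ℕ) (hK : 0 < K) :
    ∃ m : ℕ, 0 < m ∧ ∀ x : M, m • x ∈ H → ∃ h ∈ H, m • x = K • h := by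
  let S : Submodule ℤ M := AddSubgroup.toIntSubmodule H
  let T := Submodule.torsion ℤ (M ⧸ S)
  have hT : Finite T := Module.finite_of_fg_torsion T (Submodule.torsion_isTorsion)
  refine ⟨K * Nat.card T, Nat.mul_pos hK Nat.card_pos, fun x hx => ?_⟩
  have hxT : S.mkQ x ∈ T := by
    rw [Submodule.mem_torsion_iff]
    refine ⟨⟨((K * Nat.card T : ℕ) : ℤ), ?_⟩, ?_⟩
    · rw [mem_nonZeroDivisors_iff_ne_zero]
      exact_mod_cast (Nat.mul_pos hK Nat.card_pos).ne'
    · change ((K * Nat.card T : ℕ) : ℤ) • S.mkQ x = 0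
      rw [← map_smul, ← LinearMap.mem_ker, Submodule.ker_mkQ, natCast_zsmul]
      exact hx
  have h0 : Nat.card T • (⟨S.mkQ x, hxT⟩ : T) = 0 := card_nsmul_eq_zero'
  have h1 : Nat.card T • S.mkQ x = 0 := congrArg Subtype.val h0
  refine ⟨Nat.card T • x, ?_, by rw [mul_smul]⟩
  rw [← map_nsmul, ← LinearMap.mem_ker, Submodule.ker_mkQ] at h1
  exact h1

theorem reduction_eq_one_iff {n m : ℕ} (g : GL (Fin n) ℤ) :
    reduction n m g = 1 ↔ ∃ Y : Matrix (Fin n) (Fin n) ℤ, g.val - 1 = m • Y := by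
  have key : reduction n m g = 1 ↔ ∀ i j, ((g.val i j : ℤ) : ZMod m) =
      ((1 : Matrix (Fin n) (Fin n) ℤ) i j : ℤ) := by
    rw [Units.ext_iff, ← Matrix.ext_iff]
    refine forall₂_congr fun i j => ?_
    have : ((reduction n m g).val i j) = ((g.val i j : ℤ) : ZMod m) := rfl
    rw [this, Units.val_one, Matrix.one_apply, Matrix.one_apply]
    split_ifs <;> simp
  rw [key]
  constructor
  · intro h
    have h' : ∀ i j, ∃ y : ℤ, (g.val - 1) i j = m * y := fun i j => by
      have := (ZMod.intCast_eq_intCast_iff_dvd_sub _ _ _).1 (h i j).symm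
      exact this
    choose Y hY using h'
    exact ⟨Matrix.of Y, by ext i j; rw [hY]; simp⟩
  · rintro ⟨Y, hY⟩ i j
    refine ((ZMod.intCast_eq_intCast_iff_dvd_sub _ _ _).2 ⟨Y i j, ?_⟩).symm
    have := congrFun (congrFun hY i) j
    simpa using this

section Step

variable {R : Type*} [Ring R] (J J' : AddSubgroup R)

theorem pow_sub_one_sub_nsmul_mem (hle : J' ≤ J) {z : Rˣ} (hz : z.val - 1 ∈ J)
    (hmul : ∀ x ∈ J, x * (z.val - 1) ∈ J') (j : ℕ) :
    (z ^ j).val - 1 - j • (z.val - 1) ∈ J' := by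
  induction j with
  | zero => simp
  | succ j ih =>
    have h1 := hmul _ (J.add_mem (hle ih) (J.nsmul_mem hz j))
    have h2 := J'.add_mem ih h1
    convert h2 using 1
    rw [pow_succ, Units.val_mul, succ_nsmul]
    noncomm_ring

theorem inv_pow_mul_mul_pow_sub_mem (hle : J' ≤ J) {γ y : Rˣ} (hy : y.val - 1 ∈ J)
    (hmul : ∀ x ∈ J, x * (y.val - 1) ∈ J')
    (hconj : ∀ x ∈ J', (γ⁻¹).val * x * γ.val ∈ J')
    (hcomm : (γ⁻¹).val * (y.val - 1) * γ.val - (y.val - 1) ∈ J') (j : ℕ) :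
    ((γ ^ j)⁻¹ * (γ * y) ^ j).val - 1 - j • (y.val - 1) ∈ J' := by
  induction j with
  | zero => simp
  | succ j ih =>
    set W := ((γ ^ j)⁻¹ * (γ * y) ^ j).val with hW
    set F := (γ⁻¹).val * (W - 1 - j • (y.val - 1)) * γ.val +
      j • ((γ⁻¹).val * (y.val - 1) * γ.val - (y.val - 1)) with hF
    have hFm : F ∈ J' := J'.add_mem (hconj _ ih) (J'.nsmul_mem hcomm j)
    have hFe : (γ⁻¹).val * W * γ.val = 1 + j • (y.val - 1) + F := by
      rw [hF]
      generalize y.val - 1 = t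
      rw [mul_sub, mul_sub, sub_mul, sub_mul, mul_one, Units.inv_mul, smul_sub, mul_smul_comm,
        smul_mul_assoc]
      abel
    have e : ((γ ^ (j + 1))⁻¹ * (γ * y) ^ (j + 1)).val = ((γ⁻¹).val * W * γ.val) * y.val := by
      rw [hW, ← Units.val_mul, ← Units.val_mul, ← Units.val_mul]
      congr 1
      rw [pow_succ γ, pow_succ (γ * y)]
      group
    have h2 := J'.add_mem hFm (hmul _ (J.add_mem (hle hFm) (J.nsmul_mem hy j)))
    convert h2 using 1
    rw [e, hFe, succ_nsmul]
    noncomm_ring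

end Step

theorem inv_pow_mul_mul_pow_mem {G : Type*} [Group G] {N : Subgroup G} {γ y : G}
    (hN : ∀ u ∈ N, γ⁻¹ * u * γ ∈ N) (hy : y ∈ N) (j : ℕ) : (γ ^ j)⁻¹ * (γ * y) ^ j ∈ N := by
  induction j with
  | zero => simp
  | succ j ih =>
    have h := N.mul_mem (hN _ ih) hy
    convert h using 1
    rw [pow_succ γ, pow_succ (γ * y)]
    group

/-- If `γ ^ k` lies in a filtration step `J` and is close to `1` in the congruence topology, then
`γ` can be corrected by an element of `N` so that its `k`-th power lies in the next step `J'`. -/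
theorem exists_correction {n : ℕ} (N Γ : Subgroup (GL (Fin n) ℤ))
    (hN : ∀ γ ∈ Γ, ∀ u ∈ N, γ⁻¹ * u * γ ∈ N)
    (J J' : AddSubgroup (Matrix (Fin n) (Fin n) ℤ)) (hle : J' ≤ J)
    (hsat : ∀ (c : ℕ) (x : Matrix (Fin n) (Fin n) ℤ), c ≠ 0 → c • x ∈ J' → x ∈ J')
    (hconj : ∀ γ ∈ Γ, ∀ x ∈ J', (γ⁻¹).val * x * γ.val ∈ J')
    (hmul : ∀ x ∈ J, ∀ u ∈ N, x * (u.val - 1) ∈ J')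
    (k : ℕ) (hk : 0 < k) (m' : ℕ) (hm' : 0 < m') :
    ∃ m : ℕ, 0 < m ∧ ∀ γ ∈ Γ, γ ^ k ∈ N → (γ ^ k).val - 1 ∈ J → reduction n m (γ ^ k) = 1 →
      ∃ y ∈ N, (γ * y) ^ k ∈ N ∧ ((γ * y) ^ k).val - 1 ∈ J' ∧
        reduction n m' ((γ * y) ^ k) = 1 := by
  have : NeZero m' := ⟨hm'.ne'⟩
  set K' := Nat.card (GL (Fin n) (ZMod m')) with hK'
  have hK'pos : 0 < K' := Nat.card_pos
  let H : AddSubgroup (Matrix (Fin n) (Fin n) ℤ) :=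
    { carrier := {x | ∃ u ∈ N, u.val - 1 ∈ J ∧ x - (u.val - 1) ∈ J'}
      zero_mem' := ⟨1, N.one_mem, by simp, by simp⟩
      add_mem' := by
        rintro x x' ⟨u, hu, huJ, hx⟩ ⟨v, hv, hvJ, hx'⟩
        have huv := hmul _ huJ _ hv
        have e : (u * v).val - 1 = (u.val - 1) + (v.val - 1) + (u.val - 1) * (v.val - 1) := by
          rw [Units.val_mul]; noncomm_ring
        refine ⟨u * v, N.mul_mem hu hv, ?_, ?_⟩
        · rw [e]
          exact J.add_mem (J.add_mem huJ hvJ) (hle huv)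
        · have h := J'.sub_mem (J'.add_mem hx hx') huv
          rw [e]
          convert h using 1
          abel
      neg_mem' := by
        rintro x ⟨u, hu, huJ, hx⟩
        have huv := hmul _ huJ _ (N.inv_mem hu)
        have e : (u⁻¹).val - 1 = -(u.val - 1) - (u.val - 1) * ((u⁻¹).val - 1) := by
          have := u.mul_inv
          rw [sub_mul, mul_sub, this]; noncomm_ring
        refine ⟨u⁻¹, N.inv_mem hu, ?_, ?_⟩
        · rw [e]
          exact J.sub_mem (J.neg_mem huJ) (hle huv)
        · have h := J'.add_mem (J'.neg_mem hx) huv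
          rw [e]
          convert h using 1
          abel }
  obtain ⟨m₁, hm₁, hdiv⟩ := exists_smul_mem_imp_eq_smul H (k * K') (Nat.mul_pos hk hK'pos)
  refine ⟨m₁ * m', Nat.mul_pos hm₁ hm', fun γ hγ hγN hγJ hγm => ?_⟩
  obtain ⟨Y, hY⟩ := (reduction_eq_one_iff _).1 hγm
  have hγm' : reduction n m' (γ ^ k) = 1 :=
    (reduction_eq_one_iff _).2 ⟨m₁ • Y, by rw [hY, smul_smul, mul_comm]⟩
  obtain ⟨h, hh, hYh⟩ := hdiv (m' • Y) (by
    rw [smul_smul, ← hY]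
    exact ⟨_, hγN, hγJ, by simp⟩)
  rw [smul_smul, ← hY] at hYh
  obtain ⟨z, hzN, hzJ, hz⟩ := H.neg_mem hh
  have hpow := pow_sub_one_sub_nsmul_mem J J' hle hzJ (fun x hx => hmul x hx z hzN) K'
  set y := z ^ K' with hy
  have hyN : y ∈ N := N.pow_mem hzN _
  have hyJ : y.val - 1 ∈ J := by
    have := J.add_mem (hle hpow) (J.nsmul_mem hzJ K')
    simpa using this
  have hky : ((γ ^ k).val - 1) + k • (y.val - 1) ∈ J' := by
    have := J'.sub_mem (J'.nsmul_mem hpow k) (J'.nsmul_mem hz (k * K'))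
    convert this using 1
    rw [hYh]
    simp only [mul_smul, smul_sub, smul_neg]
    abel
  have hcomm : (γ⁻¹).val * (y.val - 1) * γ.val - (y.val - 1) ∈ J' := by
    refine hsat k _ hk.ne' ?_
    have := J'.sub_mem (hconj γ hγ _ hky) hky
    convert this using 1
    have e : (γ⁻¹).val * (γ ^ k).val * γ.val = (γ ^ k).val := by
      rw [← Units.val_mul, ← Units.val_mul]
      congr 1
      group
    have e1 : (γ⁻¹).val * γ.val = 1 := γ.inv_mul
    generalize y.val - 1 = t
    rw [mul_add, add_mul, mul_sub, sub_mul, e, mul_one, e1, mul_smul_comm, smul_mul_assoc,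
      smul_sub]
    abel
  have hE := inv_pow_mul_mul_pow_sub_mem J J' hle hyJ (fun x hx => hmul x hx y hyN)
    (hconj γ hγ) hcomm k
  have hWN := inv_pow_mul_mul_pow_mem (hN γ hγ) hyN k
  set W := (γ ^ k)⁻¹ * (γ * y) ^ k with hW
  have hWe : (γ * y) ^ k = γ ^ k * W := by rw [hW]; group
  refine ⟨y, hyN, ?_, ?_, ?_⟩
  · rw [hWe]
    exact N.mul_mem hγN hWN
  · have h1 := hmul _ hγJ _ hWN
    have h2 := J'.add_mem (J'.add_mem hE hky) h1
    rw [hWe, Units.val_mul]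
    convert h2 using 1
    noncomm_ring
  · have hyr : reduction n m' y = 1 := by rw [hy, map_pow, hK', pow_card_eq_one']
    rw [map_pow, map_mul, hyr, mul_one, ← map_pow, hγm']

/-- Iteration of the correction along a finite filtration. -/
theorem exists_torsion_correction {n : ℕ} (N Γ : Subgroup (GL (Fin n) ℤ)) (hNΓ : N ≤ Γ)
    (hN : ∀ γ ∈ Γ, ∀ u ∈ N, γ⁻¹ * u * γ ∈ N)
    (J : ℕ → AddSubgroup (Matrix (Fin n) (Fin n) ℤ)) (hle : ∀ i, J (i + 1) ≤ J i)
    (hsat : ∀ i (c : ℕ) (x : Matrix (Fin n) (Fin n) ℤ), c ≠ 0 → c • x ∈ J i → x ∈ J i)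
    (hconj : ∀ i, ∀ γ ∈ Γ, ∀ x ∈ J i, (γ⁻¹).val * x * γ.val ∈ J i)
    (hmul : ∀ i, ∀ x ∈ J i, ∀ u ∈ N, x * (u.val - 1) ∈ J (i + 1))
    (k : ℕ) (hk : 0 < k) (r : ℕ) : ∀ i, J (i + r) = ⊥ →
    ∃ m : ℕ, 0 < m ∧ ∀ γ ∈ Γ, γ ^ k ∈ N → (γ ^ k).val - 1 ∈ J i → reduction n m (γ ^ k) = 1 →
      ∃ y ∈ N, (γ * y) ^ k = 1 := by
  induction r with
  | zero =>
    intro i hi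
    refine ⟨1, one_pos, fun γ _ _ hγJ _ => ⟨1, N.one_mem, ?_⟩⟩
    rw [add_zero] at hi
    rw [hi, AddSubgroup.mem_bot, sub_eq_zero] at hγJ
    rw [mul_one]
    exact Units.ext hγJ
  | succ r ih =>
    intro i hi
    obtain ⟨m', hm', h'⟩ := ih (i + 1) (by rw [← hi]; congr 1; ring)
    obtain ⟨m, hm, h⟩ := exists_correction N Γ hN (J i) (J (i + 1)) (hle i) (hsat _)
      (hconj _) (hmul i) k hk m' hm'
    refine ⟨m, hm, fun γ hγ hγN hγJ hγm => ?_⟩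
    obtain ⟨y, hy, h1, h2, h3⟩ := h γ hγ hγN hγJ hγm
    obtain ⟨y', hy', h4⟩ := h' (γ * y) (Γ.mul_mem hγ (hNΓ hy)) h1 h2 h3
    exact ⟨y * y', N.mul_mem hy hy', by rw [← mul_assoc, h4]⟩

/-- The conjugate by `P` of the matrices vanishing below the `i`-th superdiagonal. -/
def shiftedUpper {n : ℕ} (P : GL (Fin n) ℂ) (i : ℕ) : Submodule ℂ (Matrix (Fin n) (Fin n) ℂ) where
  carrier := {X | ∀ a b : Fin n, (b : ℕ) < a + i → ((P⁻¹).val * X * P.val) a b = 0}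
  zero_mem' := by intro a b _; simp
  add_mem' := by
    intro X Y hX hY a b hab
    rw [mul_add, add_mul, Matrix.add_apply, hX a b hab, hY a b hab, add_zero]
  smul_mem' := by
    intro c X hX a b hab
    rw [mul_smul_comm, smul_mul_assoc, Matrix.smul_apply, hX a b hab, smul_zero]

theorem shiftedUpper_mul_le {n : ℕ} (P : GL (Fin n) ℂ) (i j : ℕ) :
    shiftedUpper P i * shiftedUpper P j ≤ shiftedUpper P (i + j) := by
  rw [Submodule.mul_le]
  intro X hX Y hY a b hab
  have e : (P⁻¹).val * (X * Y) * P.val = ((P⁻¹).val * X * P.val) * ((P⁻¹).val * Y * P.val) := by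
    have : P.val * (P⁻¹).val = 1 := P.mul_inv
    simp only [mul_assoc]
    rw [← mul_assoc P.val, this, one_mul]
  rw [e, Matrix.mul_apply]
  refine Finset.sum_eq_zero fun c _ => ?_
  by_cases hc : (c : ℕ) < a + i
  · rw [hX a c hc, zero_mul]
  · rw [hY c b (by omega), mul_zero]

theorem shiftedUpper_pow_le {n : ℕ} (P : GL (Fin n) ℂ) (i : ℕ) :
    shiftedUpper P 1 ^ (i + 1) ≤ shiftedUpper P (i + 1) := by
  induction i with
  | zero => simp
  | succ i ih =>
    rw [pow_succ]
    exact (mul_le_mul' ih le_rfl).trans (shiftedUpper_mul_le P _ _)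

theorem shiftedUpper_eq_bot {n i : ℕ} (hi : n ≤ i) (P : GL (Fin n) ℂ) :
    shiftedUpper P i = ⊥ := by
  rw [eq_bot_iff]
  intro X hX
  have h0 : (P⁻¹).val * X * P.val = 0 := by
    ext a b
    exact hX a b (by omega)
  have h1 : P.val * (P⁻¹).val = 1 := P.mul_inv
  have : X = P.val * ((P⁻¹).val * X * P.val) * (P⁻¹).val := by
    simp only [mul_assoc]
    rw [h1, mul_one, ← mul_assoc, h1, one_mul]
  rw [Submodule.mem_bot, this, h0, mul_zero, zero_mul]

/-- The complex span of the matrices `u - 1` for `u ∈ N`. -/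
def augmentation {n : ℕ} (N : Subgroup (GL (Fin n) ℤ)) :
    Submodule ℂ (Matrix (Fin n) (Fin n) ℂ) :=
  Submodule.span ℂ {X | ∃ u ∈ N, X = (toComplex n u).val - 1}

theorem augmentation_mul_le {n : ℕ} (N : Subgroup (GL (Fin n) ℤ)) :
    augmentation N * augmentation N ≤ augmentation N := by
  unfold augmentation
  rw [Submodule.span_mul_span, Submodule.span_le]
  rintro _ ⟨_, ⟨u, hu, rfl⟩, _, ⟨v, hv, rfl⟩, rfl⟩
  have e : ((toComplex n u).val - 1) * ((toComplex n v).val - 1) =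
      ((toComplex n (u * v)).val - 1) - ((toComplex n u).val - 1) - ((toComplex n v).val - 1) := by
    rw [map_mul, Units.val_mul]; noncomm_ring
  change ((toComplex n u).val - 1) * ((toComplex n v).val - 1) ∈ Submodule.span ℂ _
  rw [e]
  exact sub_mem (sub_mem (Submodule.subset_span ⟨_, N.mul_mem hu hv, rfl⟩)
    (Submodule.subset_span ⟨_, hu, rfl⟩)) (Submodule.subset_span ⟨_, hv, rfl⟩)

theorem augmentation_pow_succ_le {n : ℕ} (N : Subgroup (GL (Fin n) ℤ)) (i : ℕ) :
    augmentation N ^ (i + 1 + 1) ≤ augmentation N ^ (i + 1) := by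
  rw [pow_succ _ (i + 1), pow_succ, mul_assoc]
  exact mul_le_mul' le_rfl (augmentation_mul_le N)

theorem conj_mem_augmentation_pow {n : ℕ} {N : Subgroup (GL (Fin n) ℤ)} {γ : GL (Fin n) ℤ}
    (hN : ∀ u ∈ N, γ⁻¹ * u * γ ∈ N) (i : ℕ) :
    ∀ x ∈ augmentation N ^ (i + 1),
      (toComplex n γ⁻¹).val * x * (toComplex n γ).val ∈ augmentation N ^ (i + 1) := by
  have hinv : (toComplex n γ⁻¹).val * (toComplex n γ).val = 1 := by
    rw [← Units.val_mul, ← map_mul]; simp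
  have hinv' : (toComplex n γ).val * (toComplex n γ⁻¹).val = 1 := by
    rw [← Units.val_mul, ← map_mul]; simp
  have h1 : ∀ x ∈ augmentation N,
      (toComplex n γ⁻¹).val * x * (toComplex n γ).val ∈ augmentation N := by
    intro x hx
    induction hx using Submodule.span_induction with
    | mem x hx =>
      obtain ⟨u, hu, rfl⟩ := hx
      refine Submodule.subset_span ⟨γ⁻¹ * u * γ, hN u hu, ?_⟩
      rw [map_mul, map_mul, Units.val_mul, Units.val_mul, mul_sub, sub_mul, mul_one, hinv]
    | zero => simp
    | add x y _ _ hx hy =>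
      rw [mul_add, add_mul]
      exact add_mem hx hy
    | smul c x _ hx =>
      rw [mul_smul_comm, smul_mul_assoc]
      exact Submodule.smul_mem _ _ hx
  induction i with
  | zero => simpa using h1
  | succ i ih =>
    intro x hx
    rw [pow_succ] at hx ⊢
    induction hx using Submodule.mul_induction_on' with
    | mem_mul_mem a ha b hb =>
      have h := Submodule.mul_mem_mul (ih a ha) (h1 b hb)
      convert h using 1
      simp only [mul_assoc]
      rw [← mul_assoc (toComplex n γ).val, hinv', one_mul]
    | add x _ y _ hx hy =>
      rw [mul_add, add_mul]
      exact add_mem hx hy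

/-- The integral matrices lying in the `(i + 1)`-st power of the augmentation space. -/
def integralFiltration {n : ℕ} (N : Subgroup (GL (Fin n) ℤ)) (i : ℕ) :
    AddSubgroup (Matrix (Fin n) (Fin n) ℤ) :=
  (augmentation N ^ (i + 1)).toAddSubgroup.comap
    ((Int.castRingHom ℂ).mapMatrix : Matrix (Fin n) (Fin n) ℤ →+* _).toAddMonoidHom

theorem mem_integralFiltration {n : ℕ} {N : Subgroup (GL (Fin n) ℤ)} {i : ℕ}
    {x : Matrix (Fin n) (Fin n) ℤ} :
    x ∈ integralFiltration N i ↔ (Int.castRingHom ℂ).mapMatrix x ∈ augmentation N ^ (i + 1) :=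
  Iff.rfl

theorem mapMatrix_val {n : ℕ} (g : GL (Fin n) ℤ) :
    (Int.castRingHom ℂ).mapMatrix g.val = (toComplex n g).val := rfl

theorem mapMatrix_injective (n : ℕ) : Function.Injective
    ((Int.castRingHom ℂ).mapMatrix : Matrix (Fin n) (Fin n) ℤ →+* Matrix (Fin n) (Fin n) ℂ) :=
  Matrix.map_injective Int.cast_injective

theorem augmentation_le_shiftedUpper {n : ℕ} {N : Subgroup (GL (Fin n) ℤ)}
    {U : Subgroup (GL (Fin n) ℂ)} (hNU : ∀ u ∈ N, toComplex n u ∈ U) {P : GL (Fin n) ℂ}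
    (hP : ∀ g ∈ U, (∀ i j : Fin n, j < i → (P⁻¹ * g * P : GL (Fin n) ℂ).val i j = 0) ∧
      (∀ i : Fin n, (P⁻¹ * g * P : GL (Fin n) ℂ).val i i = 1)) :
    augmentation N ≤ shiftedUpper P 1 := by
  refine Submodule.span_le.2 ?_
  rintro _ ⟨u, hu, rfl⟩ a b hab
  obtain ⟨h1, h2⟩ := hP _ (hNU u hu)
  have hinv : (P⁻¹).val * P.val = 1 := P.inv_mul
  rw [mul_sub, sub_mul, mul_one, hinv, ← Units.val_mul, ← Units.val_mul, Matrix.sub_apply]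
  rcases lt_or_eq_of_le (show b ≤ a from Fin.le_def.2 (by omega)) with h | h
  · rw [h1 a b h, Matrix.one_apply_ne h.ne', sub_zero]
  · subst h
    rw [h2, Matrix.one_apply_eq, sub_self]

theorem augmentation_pow_eq_bot {n : ℕ} {N : Subgroup (GL (Fin n) ℤ)}
    {U : Subgroup (GL (Fin n) ℂ)} (hNU : ∀ u ∈ N, toComplex n u ∈ U)
    (hU : IsUnipotentSubgroup U) : augmentation N ^ (n + 1) = ⊥ := by
  obtain ⟨P, hP⟩ := hU
  rw [eq_bot_iff, ← shiftedUpper_eq_bot n.le_succ P]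
  exact (pow_le_pow_left' (augmentation_le_shiftedUpper hNU hP) _).trans (shiftedUpper_pow_le P n)

theorem sub_one_mem_augmentation {n : ℕ} {N : Subgroup (GL (Fin n) ℤ)} {u : GL (Fin n) ℤ}
    (hu : u ∈ N) : (Int.castRingHom ℂ).mapMatrix (u.val - 1) ∈ augmentation N := by
  rw [map_sub, map_one, mapMatrix_val]
  exact Submodule.subset_span ⟨u, hu, rfl⟩

theorem sub_one_pow_eq_zero {n : ℕ} {N : Subgroup (GL (Fin n) ℤ)}
    (hA : augmentation N ^ (n + 1) = ⊥) {u : GL (Fin n) ℤ} (hu : u ∈ N) :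
    (u.val - 1) ^ (n + 1) = 0 := by
  apply mapMatrix_injective n
  have := Submodule.pow_mem_pow _ (sub_one_mem_augmentation hu) (n + 1)
  rw [hA, Submodule.mem_bot] at this
  rw [map_pow, this, map_zero]

/-- For a group `Γ` with a normal unipotent subgroup `N`, an element whose `k`-th power lies in `N`
and is sufficiently close to `1` in the congruence topology is a torsion element modulo a
correction from `N`. -/
theorem exists_congruence_torsion_correction {n : ℕ} (N Γ : Subgroup (GL (Fin n) ℤ)) (hNΓ : N ≤ Γ)
    (hN : ∀ γ ∈ Γ, ∀ u ∈ N, γ⁻¹ * u * γ ∈ N) (hA : augmentation N ^ (n + 1) = ⊥)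
    (k : ℕ) (hk : 0 < k) :
    ∃ m : ℕ, 0 < m ∧ ∀ γ ∈ Γ, γ ^ k ∈ N → reduction n m (γ ^ k) = 1 →
      ∃ y ∈ N, (γ * y) ^ k = 1 := by
  obtain ⟨m, hm, h⟩ := exists_torsion_correction N Γ hNΓ hN (integralFiltration N)
    (fun i x hx => augmentation_pow_succ_le N i hx)
    (fun i c x hc hx => by
      rw [mem_integralFiltration, map_nsmul, ← Nat.cast_smul_eq_nsmul ℂ] at hx
      exact (Submodule.smul_mem_iff _ (Nat.cast_ne_zero.2 hc)).1 hx)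
    (fun i γ hγ x hx => by
      rw [mem_integralFiltration] at hx ⊢
      rw [map_mul, map_mul]
      exact conj_mem_augmentation_pow (hN γ hγ) i _ hx)
    (fun i x hx u hu => by
      rw [mem_integralFiltration] at hx ⊢
      rw [map_mul, pow_succ]
      exact Submodule.mul_mem_mul hx (sub_one_mem_augmentation hu))
    k hk n 0 (by
      rw [zero_add, eq_bot_iff]
      intro x hx
      rw [mem_integralFiltration, hA, Submodule.mem_bot] at hx
      exact mapMatrix_injective n (hx.trans (map_zero _).symm))
  refine ⟨m, hm, fun γ hγ hγN => h γ hγ hγN ?_⟩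
  rw [mem_integralFiltration, zero_add, pow_one]
  exact sub_one_mem_augmentation hγN

theorem IsSemisimpleElement.pow {n : ℕ} {η : GL (Fin n) ℤ} (hη : IsSemisimpleElement η) (d : ℕ) :
    IsSemisimpleElement (η ^ d) := by
  obtain ⟨s, hs, ⟨P, hP⟩, -, -⟩ := hη
  refine ⟨s ^ d, by rw [map_pow, hs, mul_one, mul_one], ⟨P, ?_⟩, by simp, Commute.one_right _⟩
  have e : P⁻¹ * s ^ d * P = (P⁻¹ * s * P) ^ d := by
    have := conj_pow (a := P⁻¹) (b := s) (i := d)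
    rw [inv_inv] at this
    exact this.symm
  rw [e, Units.val_pow_eq_pow_val, ← hP.diagonal_diag, Matrix.diagonal_pow]
  exact Matrix.isDiag_diagonal _

theorem IsSemisimpleElement.eq_one_of_sub_one_pow_eq_zero {n : ℕ} {η : GL (Fin n) ℤ}
    (hη : IsSemisimpleElement η) {r : ℕ} (h : (η.val - 1) ^ r = 0) : η = 1 := by
  obtain ⟨s, hs, ⟨P, hP⟩, -, -⟩ := hη
  rw [mul_one] at hs
  have h1 : (s.val - 1) ^ r = 0 := by
    rw [← hs, ← mapMatrix_val, ← map_one (Int.castRingHom ℂ).mapMatrix, ← map_sub, ← map_pow, h,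
      map_zero]
  set D := P⁻¹ * s * P with hD
  have hsD : s = P * D * P⁻¹ := by rw [hD]; group
  have hinv : P.val * (P⁻¹).val = 1 := P.mul_inv
  have hinv' : (P⁻¹).val * P.val = 1 := P.inv_mul
  have h2 : (D.val - 1) ^ r = 0 := by
    have e : D.val - 1 = (P⁻¹).val * (s.val - 1) * P.val := by
      rw [hD, mul_sub, sub_mul, mul_one, hinv']; rfl
    have e' : (D.val - 1) ^ r = (P⁻¹).val * (s.val - 1) ^ r * P.val := by
      rw [e]; exact Units.conj_pow P⁻¹ _ r
    rw [e', h1, mul_zero, zero_mul]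
  have h3 : D = 1 := by
    rw [← hP.diagonal_diag, ← Matrix.diagonal_one, Matrix.diagonal_sub, Matrix.diagonal_pow] at h2
    refine Units.ext ?_
    rw [← hP.diagonal_diag, Units.val_one, ← Matrix.diagonal_one]
    congr 1
    ext i
    have h4 := congrFun (congrFun h2 i) i
    rw [Matrix.diagonal_apply_eq, Pi.pow_apply, Matrix.zero_apply] at h4
    exact sub_eq_zero.1 (eq_zero_of_pow_eq_zero h4)
  rw [h3, mul_one, mul_inv_cancel] at hsD
  refine Units.ext (mapMatrix_injective n ?_)
  rw [mapMatrix_val, hs, hsD, Units.val_one, Units.val_one, map_one]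

/-- A nonzero integral matrix is nonzero modulo some `m`, together with all multiples of `m`. -/
theorem exists_forall_dvd_map_ne_zero {n : ℕ} {X : Matrix (Fin n) (Fin n) ℤ} (hX : X ≠ 0) :
    ∃ m : ℕ, 0 < m ∧ ∀ m', m ∣ m' → (Int.castRingHom (ZMod m')).mapMatrix X ≠ 0 := by
  obtain ⟨i, j, hij⟩ : ∃ i j, X i j ≠ 0 := by
    by_contra! h
    exact hX (Matrix.ext h)
  refine ⟨(X i j).natAbs + 1, Nat.succ_pos _, fun m' hm' h => ?_⟩
  have h1 : ((X i j : ℤ) : ZMod m') = 0 := congrFun (congrFun h i) j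
  have h2 := (Int.natCast_dvd_natCast.2 hm').trans
    ((ZMod.intCast_zmod_eq_zero_iff_dvd _ _).1 h1)
  exact hij (Int.eq_zero_of_abs_lt_dvd h2 (by
    push_cast; exact lt_add_one _))

/-- Unipotence modulo `m` is invariant under conjugation. -/
theorem map_sub_one_pow_eq_zero_of_isConj {n m r : ℕ} {η γ : GL (Fin n) ℤ}
    (hc : IsConj (reduction n m η) (reduction n m γ)) (hγ : (γ.val - 1) ^ r = 0) :
    (Int.castRingHom (ZMod m)).mapMatrix ((η.val - 1) ^ r) = 0 := by
  have e : ∀ g : GL (Fin n) ℤ, (Int.castRingHom (ZMod m)).mapMatrix ((g.val - 1) ^ r) =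
      ((reduction n m g).val - 1) ^ r := fun g => by
    rw [map_pow, map_sub, map_one]; rfl
  obtain ⟨c, hc⟩ := isConj_iff.1 hc.symm
  have hinv : c.val * (c⁻¹).val = 1 := c.mul_inv
  have e1 : (reduction n m η).val - 1 = c.val * ((reduction n m γ).val - 1) * (c⁻¹).val := by
    rw [← hc, mul_sub, sub_mul, mul_one, hinv]; rfl
  have e2 : ((reduction n m η).val - 1) ^ r =
      c.val * ((reduction n m γ).val - 1) ^ r * (c⁻¹).val := by
    rw [e1]; exact Units.conj_pow c _ r
  rw [e, e2, ← e, hγ, map_zero, mul_zero, zero_mul]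

/-- A subgroup with virtually unipotent image in `GL(n, ℂ)` has a normal subgroup of finite index
consisting of unipotents. -/
theorem exists_normal_unipotent {n : ℕ} {Γ : Subgroup (GL (Fin n) ℤ)}
    (hΓu : IsVirtuallyUnipotent (Γ.map (toComplex n))) :
    ∃ N : Subgroup (GL (Fin n) ℤ), N ≤ Γ ∧ (∀ γ ∈ Γ, ∀ u ∈ N, γ⁻¹ * u * γ ∈ N) ∧
      (∃ d : ℕ, 0 < d ∧ ∀ γ ∈ Γ, γ ^ d ∈ N) ∧ augmentation N ^ (n + 1) = ⊥ := by
  obtain ⟨U, -, hfin, hU⟩ := hΓu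
  let f : Γ →* Γ.map (toComplex n) := (toComplex n).subgroupMap Γ
  let V : Subgroup Γ := (U.subgroupOf (Γ.map (toComplex n))).comap f
  have hV : V.FiniteIndex := ⟨by
    rw [Subgroup.index_comap_of_surjective _ ((toComplex n).subgroupMap_surjective Γ)]
    exact hfin.index_ne_zero⟩
  have hfinN : V.normalCore.FiniteIndex := inferInstance
  refine ⟨V.normalCore.map Γ.subtype, Subgroup.map_subtype_le _, ?_, ?_, ?_⟩
  · rintro γ hγ _ ⟨v, hv, rfl⟩
    have := V.normalCore_normal.conj_mem v hv ⟨γ, hγ⟩⁻¹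
    rw [inv_inv] at this
    exact ⟨_, this, rfl⟩
  · refine ⟨V.normalCore.index, Nat.pos_of_ne_zero hfinN.index_ne_zero, fun γ hγ => ?_⟩
    exact ⟨⟨γ, hγ⟩ ^ V.normalCore.index, V.normalCore.pow_index_mem _, rfl⟩
  · refine augmentation_pow_eq_bot (U := U) ?_ hU
    rintro _ ⟨v, hv, rfl⟩
    exact V.normalCore_le hv

end UnipotentSelberg

open UnipotentSelberg in
theorem mainTheorem1 (n : ℕ) (η : GL (Fin n) ℤ)
    (hη : UnipotentSelberg.IsSemisimpleElement η) (hη1 : η ≠ 1)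
    (Γ : Subgroup (GL (Fin n) ℤ))
    (hΓ : UnipotentSelberg.IsTorsionFreeSubgroup Γ)
    (hΓu : UnipotentSelberg.IsVirtuallyUnipotent (Γ.map (UnipotentSelberg.toComplex n))) :
    ∃ L : Subgroup (GL (Fin n) ℤ),
      L.FiniteIndex ∧ UnipotentSelberg.IsCongruence L ∧ Γ ≤ L ∧
      conjugatesOf η ∩ (L : Set (GL (Fin n) ℤ)) = ∅ := by
  obtain ⟨N, hNΓ, hN, ⟨d, hd, hdN⟩, hA⟩ := exists_normal_unipotent hΓu
  suffices h : ∃ m : ℕ, 0 < m ∧ ∀ γ ∈ Γ, ¬ IsConj (reduction n m η) (reduction n m γ) by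
    obtain ⟨m, hm, h⟩ := h
    have : NeZero m := ⟨hm.ne'⟩
    refine ⟨(Γ.map (reduction n m)).comap (reduction n m),
      ⟨by rw [Subgroup.index_comap]; exact Subgroup.index_ne_zero_of_finite⟩,
      ⟨m, hm, fun g hg => ?_⟩, Subgroup.le_comap_map _ _, ?_⟩
    · rw [Subgroup.mem_comap, MonoidHom.mem_ker.1 hg]
      exact Subgroup.one_mem _
    · rw [Set.eq_empty_iff_forall_notMem]
      rintro g ⟨hg, γ, hγ, hγg⟩
      refine h γ hγ ?_
      rw [hγg]
      exact (reduction n m).map_isConj hg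
  by_cases hηd : η ^ d = 1
  · obtain ⟨m₁, hm₁, h₁⟩ := exists_forall_dvd_map_ne_zero
      (fun h => hη1 (hη.eq_one_of_sub_one_pow_eq_zero (r := n + 1) h))
    obtain ⟨m₂, hm₂, h₂⟩ := exists_congruence_torsion_correction N Γ hNΓ hN hA d hd
    refine ⟨m₁ * m₂, Nat.mul_pos hm₁ hm₂, fun γ hγ hc => ?_⟩
    have hγd : reduction n (m₁ * m₂) (γ ^ d) = 1 := by
      have := hc.pow d
      rwa [← map_pow, ← map_pow, hηd, map_one, isConj_one_right] at this
    have hγd' : reduction n m₂ (γ ^ d) = 1 := by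
      obtain ⟨Y, hY⟩ := (reduction_eq_one_iff _).1 hγd
      exact (reduction_eq_one_iff _).2 ⟨m₁ • Y, by rw [hY, smul_smul, mul_comm]⟩
    obtain ⟨y, hy, hyd⟩ := h₂ γ hγ (hdN γ hγ) hγd'
    have h1 : γ * y = 1 := hΓ _ (Γ.mul_mem hγ (hNΓ hy)) (isOfFinOrder_iff_pow_eq_one.2 ⟨d, hd, hyd⟩)
    have hγN : γ ∈ N := by
      rw [eq_inv_of_mul_eq_one_left h1]
      exact N.inv_mem hy
    exact h₁ _ (dvd_mul_right _ _)
      (map_sub_one_pow_eq_zero_of_isConj hc (sub_one_pow_eq_zero hA hγN))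
  · obtain ⟨m, hm, h⟩ := exists_forall_dvd_map_ne_zero
      (fun h => hηd ((hη.pow d).eq_one_of_sub_one_pow_eq_zero (r := n + 1) h))
    refine ⟨m, hm, fun γ hγ hc => h m dvd_rfl ?_⟩
    refine map_sub_one_pow_eq_zero_of_isConj (γ := γ ^ d) ?_
      (sub_one_pow_eq_zero hA (hdN γ hγ))
    rw [map_pow, map_pow]
    exact hc.pow d
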